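/- A pebbling of a finite graph $G=(V,E)$ is a function $\phi:V\to\{0,1,2,\dots\}$; its size is $\sum_{v}\phi(v)$. A step removes two pebbles from a vertex $x$ with $\phi(x)\ge 2$ and adds one pebble to a vertex adjacent to $x$. The pebbling number of $G$ is the least $m$ such that from every pebbling of size $m$ and for every vertex $x$, some finite (possibly empty) sequence of steps leads to a pebbling with at least one pebble on $x$. The graph $G$ is Class $0$ if its pebbling number equals $|V|$. Let $\mathcal G_{n,p}$ be the random graph on $n$ vertices in which each of the $\binom n2$ possible edges appears independently with probability $p\in[0,1]$. For functions on the natural numbers write $f\ll g$ (or $g\gg f$, or $f\in o(g)$) if $f(n)/g(n)\to 0$ as $n\to\infty$ (meaning: for every $\varepsilon>0$, $|f(n)|\le\varepsilon|g(n)|$ for all large $n$). Let $th(\text{Class }0)$ be the set of functions $t:\mathbb N\to\mathbb R$ such that, for every $p=p(n)\in[0,1]$, $p\gg t$ implies $\Pr(\mathcal G_{n,p}\text{ is Class }0)\to 1$ and $p\ll t$ implies $\Pr(\mathcal G_{n,p}\text{ is Class }0)\to 0$. Write $\lg=\log_2$. Theorem 2. The set $th(\text{Class }0)$ is nonempty,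 and for every real $d>0$, $$th(\text{Class }0)\subseteq o\bigl((n\lg n)^{1/d}/n\bigr).$$ Moreover, for every real $d>0$, if $p(n)\in[0,1]$ satisfies $p\gg (n\lg n)^{1/d}/n$, then the probability that $\mathcal G_{n,p}$ is Class $0$ tends to $1$ as $n\to\infty$. -/

import Mathlib

open Filter Topology Asymptotics

namespace Pebbling

variable {V : Type*}

/-- One pebbling step: two pebbles are removed from a vertex `x` carrying at least two pebbles, and
one pebble is added to a neighbour `y` of `x`. -/
def Step (G : SimpleGraph V) (φ ψ : V → ℕ) : Prop :=
  ∃ x y, G.Adj x y ∧ φ x = ψ x + 2 ∧ ψ y = φ y + 1 ∧ ∀ z, z ≠ x → z ≠ y → ψ z = φ z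

/-- `φ` has the potential to pebble `x`: the pebbling `φ`, or a pebbling obtained from it by a
finite sequence of steps, has a pebble at `x`. -/
def PotentialToPebble (G : SimpleGraph V) (φ : V → ℕ) (x : V) : Prop :=
  ∃ ψ, Relation.ReflTransGen (Step G) φ ψ ∧ 0 < ψ x

/-- `m` is the pebbling number of `G`: it is the least `m` such that every pebbling of size `m` has
the potential to pebble every vertex. (A disconnected graph has no pebbling number.) -/
def IsPebblingNumber [Fintype V] (G : SimpleGraph V) (m : ℕ) : Prop :=
  IsLeast {m : ℕ | ∀ φ : V → ℕ, ∑ v, φ v = m → ∀ x, PotentialToPebble G φ x} m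

/-- A finite graph is Class 0 if its pebbling number is its number of vertices. -/
def IsClassZero [Fintype V] (G : SimpleGraph V) : Prop :=
  IsPebblingNumber G (Fintype.card V)

/-- The probability that the binomial random graph on `n` vertices with edge probability `p` has the
property `P`. -/
noncomputable def prob (P : ∀ n : ℕ, SimpleGraph (Fin n) → Prop) (n : ℕ) (p : unitInterval) : ℝ :=
  (SimpleGraph.binomialRandom (Fin n) p).real {G | P n G}

/-- The threshold of a graph property `P`: the set of all functions `t` such that the random graph
has `P` with probability tending to `1` if `p ≫ t`, and with probability tending to `0` if
`p ≪ t`. Here `f ≪ g` is the relation `f =o[atTop] g`. -/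
def threshold (P : ∀ n : ℕ, SimpleGraph (Fin n) → Prop) : Set (ℕ → ℝ) :=
  {t | ∀ p : ℕ → unitInterval,
    ((t =o[atTop] fun n => (p n : ℝ)) → Tendsto (fun n => prob P n (p n)) atTop (𝓝 1)) ∧
    (((fun n => (p n : ℝ)) =o[atTop] t) → Tendsto (fun n => prob P n (p n)) atTop (𝓝 0))}

/-- The function `(n lg n)^{1/d} / n`, where `lg` is the logarithm to base `2`. -/
noncomputable def bound (d : ℝ) (n : ℕ) : ℝ :=
  ((n : ℝ) * Real.logb 2 n) ^ (1 / d) / n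

end Pebbling

/-! Fix `ε` in `(0, 1]`. If `p n ≥ n ^ ε`, then with probability tending to 1 every vertex set
grows, on passing to closed neighbourhoods, by a factor `k ≈ n ^ (ε / 2)` until it fills two thirds
of the graph; this is a union bound (`binomialRandom_real_not_expands_le`). The diameter is then at
most `2 * L` with `L` constant, so `M = 2 ^ (2 * L)` pebbles on one vertex reach everything.

The heart is deterministic (`Expands.isClassZero`). Suppose `n` pebbles cannot reach `r`. No vertex
has more than `M` pebbles, so the set `Z` of empty vertices is at most `M` times as large as the set
`H` of vertices with two. A path of pebbled vertices starting in `H` delivers a pebble to its end.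
If `Z` is small, expansion gives such a path to `r`. Otherwise no `w` can collect `M` pebbles, so
greedy packing of paths yields a bounded set `X w` that cuts `w` off from `H`
(`exists_reflTransGen_or_blocked`). For a suitable set `W`, the union of `Z` and all `X w` is too
small, compared with `W` and `H`, to stop expansion from joining `H` to some `w` by a short walk
that avoids `Z` and `X w`, a contradiction.

Thresholds exist for every nontrivial monotone property, by superposing independent copies of the
random graph (`threshold_nonempty`). Since every power `n ^ ε / n` suffices for Class 0, no
threshold can exceed a constant multiple of `bound d` infinitely often. -/

namespace Pebbling

/-! ### Pebbling moves along walks and paths. -/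

variable {V : Type*} {G : SimpleGraph V}

theorem Step.mono {G' : SimpleGraph V} (h : G ≤ G') {φ ψ : V → ℕ} (hs : Step G φ ψ) :
    Step G' φ ψ := by
  obtain ⟨x, y, hxy, h1, h2, h3⟩ := hs
  exact ⟨x, y, h hxy, h1, h2, h3⟩

theorem PotentialToPebble.mono {G' : SimpleGraph V} (h : G ≤ G') {φ : V → ℕ} {x : V}
    (hp : PotentialToPebble G φ x) : PotentialToPebble G' φ x := by
  obtain ⟨ψ, h1, h2⟩ := hp
  exact ⟨ψ, Relation.ReflTransGen.mono (fun _ _ => Step.mono h) _ _ h1, h2⟩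

theorem PotentialToPebble.of_reflTransGen {φ ψ : V → ℕ} {x : V}
    (h : Relation.ReflTransGen (Step G) φ ψ) (hp : PotentialToPebble G ψ x) :
    PotentialToPebble G φ x := by
  obtain ⟨χ, h1, h2⟩ := hp
  exact ⟨χ, h.trans h1, h2⟩

theorem not_step_of_le_one {φ ψ : V → ℕ} (h : ∀ v, φ v ≤ 1) : ¬ Step G φ ψ := by
  rintro ⟨x, y, -, h1, -, -⟩
  have := h x
  omega

/-- Fewer than `card V` pebbles, at most one to a vertex, leave some vertex out of reach. -/
theorem card_le_of_forall_potentialToPebble [Fintype V] {m : ℕ}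
    (hm : ∀ φ : V → ℕ, ∑ v, φ v = m → ∀ x, PotentialToPebble G φ x) : Fintype.card V ≤ m := by
  classical
  by_contra hlt
  push Not at hlt
  obtain ⟨S, -, hS⟩ := Finset.exists_subset_card_eq (s := (Finset.univ : Finset V))
    (n := m) (by rw [Finset.card_univ]; omega)
  obtain ⟨x, hx⟩ : ∃ x, x ∉ S := by
    by_contra hall
    push Not at hall
    have : S = Finset.univ := Finset.eq_univ_iff_forall.2 hall
    rw [this, Finset.card_univ] at hS
    omega
  obtain ⟨ψ, h1, h2⟩ := hm (fun v => if v ∈ S then 1 else 0) (by simp [hS]) x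
  rcases Relation.ReflTransGen.cases_head h1 with rfl | ⟨χ, h3, -⟩
  · simp [hx] at h2
  · exact not_step_of_le_one (fun v => by split_ifs <;> simp) h3

theorem isClassZero_iff [Fintype V] : IsClassZero G ↔
    ∀ φ : V → ℕ, ∑ v, φ v = Fintype.card V → ∀ x, PotentialToPebble G φ x :=
  ⟨fun h => h.1, fun h => ⟨h, fun _ hm => card_le_of_forall_potentialToPebble hm⟩⟩

theorem IsClassZero.mono [Fintype V] {G' : SimpleGraph V} (h : G ≤ G') (hG : IsClassZero G) :
    IsClassZero G' :=
  isClassZero_iff.2 fun φ hφ x => (isClassZero_iff.1 hG φ hφ x).mono h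

/-- Moving `t` pebbles along an edge. -/
theorem exists_reflTransGen_adj {x y : V} (hxy : G.Adj x y) (t : ℕ) (φ : V → ℕ)
    (h : 2 * t ≤ φ x) :
    ∃ ψ, Relation.ReflTransGen (Step G) φ ψ ∧ ψ y = φ y + t ∧
      ∀ z, z ≠ x → z ≠ y → ψ z = φ z := by
  classical
  suffices H : ∃ ψ, Relation.ReflTransGen (Step G) φ ψ ∧ ψ y = φ y + t ∧ ψ x + 2 * t = φ x ∧
      ∀ z, z ≠ x → z ≠ y → ψ z = φ z by
    obtain ⟨ψ, h1, h2, -, h3⟩ := H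
    exact ⟨ψ, h1, h2, h3⟩
  induction t with
  | zero => exact ⟨φ, .refl, by simp, by simp, fun _ _ _ => rfl⟩
  | succ t ih =>
    obtain ⟨ψ, h1, h2, h3, h4⟩ := ih (by omega)
    have hne := hxy.ne
    refine ⟨Function.update (Function.update ψ x (ψ x - 2)) y (ψ y + 1),
      h1.tail ⟨x, y, hxy, ?_, ?_, ?_⟩, ?_, ?_, ?_⟩
    · simp [hne]; omega
    · simp
    · intro z hz hz'; simp [hz, hz']
    · simp [h2]; omega
    · simp [hne]; omega
    · intro z hz hz'; simp [hz, hz', h4]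

theorem potentialToPebble_of_walk {v w : V} (p : G.Walk v w) (φ : V → ℕ)
    (h : 2 ^ p.length ≤ φ v) : PotentialToPebble G φ w := by
  induction p generalizing φ with
  | nil => exact ⟨φ, .refl, Nat.lt_of_lt_of_le (by simp) h⟩
  | cons hadj q ih =>
    rw [SimpleGraph.Walk.length_cons, pow_succ, mul_comm] at h
    obtain ⟨ψ, h1, h2, -⟩ := exists_reflTransGen_adj hadj _ φ h
    exact (ih ψ (by omega)).of_reflTransGen h1

/-- Along a path whose vertices other than the end `w` all carry a pebble and whose first vertex
carries two, a pebble can be moved to `w`. -/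
theorem exists_reflTransGen_path {v w : V} (p : G.Walk v w) (hp : p.IsPath) (hvw : v ≠ w)
    (φ : V → ℕ) (hv : 2 ≤ φ v) (hpos : ∀ u ∈ p.support, u ≠ w → 1 ≤ φ u) :
    ∃ ψ, Relation.ReflTransGen (Step G) φ ψ ∧ ψ w = φ w + 1 ∧ ∀ u ∉ p.support, ψ u = φ u := by
  induction p generalizing φ with
  | nil => exact absurd rfl hvw
  | @cons a b c hadj q ih =>
    rw [SimpleGraph.Walk.cons_isPath_iff] at hp
    -- The pebble that arrives at `b` joins the one already there, so `b` now has two and the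
    -- argument repeats.
    obtain ⟨ψ, h1, h2, h3⟩ := exists_reflTransGen_adj hadj 1 φ (by omega)
    by_cases hbc : b = c
    · subst hbc
      refine ⟨ψ, h1, h2, fun u hu => h3 u ?_ ?_⟩
      · rintro rfl; simp at hu
      · rintro rfl; simp at hu
    · have hpos' : ∀ u ∈ q.support, u ≠ c → 1 ≤ φ u := fun u hu huc =>
        hpos u (by simp [hu]) huc
      have hb := hpos' b (by simp) hbc
      obtain ⟨χ, h4, h5, h6⟩ := ih hp.1 hbc ψ (by omega) fun u hu huc => by
        by_cases hub : u = b
        · subst hub; omega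
        · rw [h3 u (by rintro rfl; exact hp.2 hu) hub]
          exact hpos' u hu huc
      refine ⟨χ, h1.trans h4, ?_, fun u hu => ?_⟩
      · rw [h5, h3 c (Ne.symm hvw) (Ne.symm hbc)]
      · simp only [SimpleGraph.Walk.support_cons, List.mem_cons, not_or] at hu
        rw [h6 u hu.2, h3 u hu.1 (by rintro rfl; simp at hu)]

/-- Either `m` pebbles can be brought to `w`, or few vertices meet all short walks that bring a
pebble from a vertex with two pebbles to `w` through vertices with pebbles. -/
theorem exists_reflTransGen_or_blocked (G : SimpleGraph V) (φ : V → ℕ) (w : V) (l m : ℕ) :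
    (∃ ψ, Relation.ReflTransGen (Step G) φ ψ ∧ m ≤ ψ w) ∨
    ∃ X : Finset V, X.card ≤ m * (l + 1) ∧ w ∉ X ∧ ∀ v, 2 ≤ φ v → v ≠ w → ∀ p : G.Walk v w,
      p.length ≤ l → ∃ u ∈ p.support, u ≠ w ∧ (φ u = 0 ∨ u ∈ X) := by
  classical
  -- Greedy packing: `X` collects the vertices of the paths used so far. Outside `X` and `w` the
  -- pebbling is still `φ`, so a further path that avoids `X` can be used as if nothing had
  -- happened; if there is none, `X` blocks.
  suffices H : (∃ ψ, ∃ X : Finset V, Relation.ReflTransGen (Step G) φ ψ ∧ m ≤ ψ w ∧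
      X.card ≤ m * (l + 1) ∧ w ∉ X ∧ ∀ u ∉ X, u ≠ w → ψ u = φ u) ∨
    ∃ X : Finset V, X.card ≤ m * (l + 1) ∧ w ∉ X ∧ ∀ v, 2 ≤ φ v → v ≠ w → ∀ p : G.Walk v w,
      p.length ≤ l → ∃ u ∈ p.support, u ≠ w ∧ (φ u = 0 ∨ u ∈ X) by
    rcases H with ⟨ψ, X, h1, h2, -⟩ | H
    · exact .inl ⟨ψ, h1, h2⟩
    · exact .inr H
  induction m with
  | zero => exact .inl ⟨φ, ∅, .refl, by simp, by simp, by simp, fun _ _ _ => rfl⟩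
  | succ m ih =>
    rcases ih with ⟨ψ, X, h1, h2, h3, h4, h5⟩ | ⟨X, h1, h2, h3⟩
    · by_cases hb : ∀ v, 2 ≤ φ v → v ≠ w → ∀ p : G.Walk v w,
        p.length ≤ l → ∃ u ∈ p.support, u ≠ w ∧ (φ u = 0 ∨ u ∈ X)
      · exact .inr ⟨X, h3.trans (Nat.mul_le_mul_right _ (Nat.le_succ _)), h4, hb⟩
      · left
        push Not at hb
        obtain ⟨v, hv, hvw, p, hpl, hp⟩ := hb
        have hsub : ∀ u ∈ p.bypass.support, u ≠ w → φ u ≠ 0 ∧ u ∉ X := fun u hu =>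
          hp u (p.support_bypass_subset_support hu)
        have hψ : ∀ u ∈ p.bypass.support, u ≠ w → ψ u = φ u := fun u hu huw =>
          h5 u (hsub u hu huw).2 huw
        obtain ⟨χ, h6, h7, h8⟩ := exists_reflTransGen_path p.bypass p.bypass_isPath hvw ψ
          (by rw [hψ v (by simp) hvw]; exact hv) (fun u hu huw => by
            rw [hψ u hu huw]; exact Nat.one_le_iff_ne_zero.2 (hsub u hu huw).1)
        refine ⟨χ, X ∪ p.bypass.support.toFinset.erase w, h1.trans h6, by omega, ?_, by simp [h4],
          fun u hu huw => ?_⟩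
        · have hc : p.bypass.support.toFinset.card ≤ l + 1 := by
            refine (List.toFinset_card_le _).trans ?_
            rw [SimpleGraph.Walk.length_support]
            have := p.length_bypass_le_length
            omega
          have := Finset.card_union_le X (p.bypass.support.toFinset.erase w)
          have := Finset.card_erase_le (s := p.bypass.support.toFinset) (a := w)
          rw [Nat.succ_mul]
          omega
        · simp only [Finset.mem_union, Finset.mem_erase, List.mem_toFinset, not_or, not_and] at hu
          rw [h8 u (hu.2 huw), h5 u hu.1 huw]
    · exact .inr ⟨X, h1.trans (Nat.mul_le_mul_right _ (Nat.le_succ _)), h2, h3⟩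

end Pebbling

/-! ### Expanding graphs are Class 0. -/

namespace Pebbling

variable {V : Type*} [Fintype V] {G : SimpleGraph V}

open Classical in
/-- The vertices that lie in `A` or have a neighbour in `A`. -/
noncomputable def closedNbhd (G : SimpleGraph V) (A : Finset V) : Finset V :=
  Finset.univ.filter fun v => ∃ a ∈ A, a = v ∨ G.Adj a v

theorem mem_closedNbhd {A : Finset V} {v : V} :
    v ∈ closedNbhd G A ↔ ∃ a ∈ A, a = v ∨ G.Adj a v := by
  simp [closedNbhd]

theorem subset_closedNbhd (A : Finset V) : A ⊆ closedNbhd G A := fun v hv =>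
  mem_closedNbhd.2 ⟨v, hv, .inl rfl⟩

/-- Every nonempty set of vertices has a closed neighbourhood that is `k` times as large, or
contains two thirds of the vertices. -/
def Expands (G : SimpleGraph V) (k : ℕ) : Prop :=
  ∀ A : Finset V, A.Nonempty →
    2 * Fintype.card V ≤ 3 * (closedNbhd G A).card ∨ k * A.card ≤ (closedNbhd G A).card

open Classical in
/-- The vertices joined to `w` by a walk of length at most `i` inside the set defined by `P`. -/
noncomputable def walkBall (G : SimpleGraph V) (P : V → Prop) (w : V) (i : ℕ) : Finset V :=
  Finset.univ.filter fun v => ∃ p : G.Walk v w, p.length ≤ i ∧ ∀ u ∈ p.support, P u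

theorem mem_walkBall {P : V → Prop} {v w : V} {i : ℕ} :
    v ∈ walkBall G P w i ↔ ∃ p : G.Walk v w, p.length ≤ i ∧ ∀ u ∈ p.support, P u := by
  simp [walkBall]

theorem mem_walkBall_self {P : V → Prop} {w : V} (hw : P w) (i : ℕ) : w ∈ walkBall G P w i :=
  mem_walkBall.2 ⟨.nil, by simp, by simpa using hw⟩

theorem walkBall_mono (P : V → Prop) (w : V) {i j : ℕ} (h : i ≤ j) :
    walkBall G P w i ⊆ walkBall G P w j := fun v hv => by
  obtain ⟨p, h1, h2⟩ := mem_walkBall.1 hv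
  exact mem_walkBall.2 ⟨p, h1.trans h, h2⟩

theorem mem_walkBall_succ {P : V → Prop} {a v w : V} {i : ℕ} (ha : a ∈ walkBall G P w i)
    (hav : G.Adj a v) (hv : P v) : v ∈ walkBall G P w (i + 1) := by
  obtain ⟨p, h1, h2⟩ := mem_walkBall.1 ha
  refine mem_walkBall.2 ⟨.cons hav.symm p, by simpa using h1, fun u hu => ?_⟩
  rw [SimpleGraph.Walk.support_cons, List.mem_cons] at hu
  rcases hu with rfl | hu
  · exact hv
  · exact h2 u hu

/-- In an expanding graph a growing sequence of sets, which takes in all neighbours outside a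
forbidden set `Y`, soon fills two thirds of the graph up to `Y`. -/
theorem Expands.card_le_of_growth [DecidableEq V] {k : ℕ} (hE : Expands G k) (C : ℕ → Finset V)
    (Y : Finset V) {K s L : ℕ} (hK : K < k) (hL : Fintype.card V ≤ (k - K) ^ L) (hs : 0 < s)
    (hC : s ≤ (C 0).card) (hY : Y.card ≤ K * s) (hmono : Monotone C)
    (hstep : ∀ i, closedNbhd G (C i) ⊆ C (i + 1) ∪ Y) :
    2 * Fintype.card V ≤ 3 * ((C L).card + Y.card) := by
  -- One step loses at most `Y.card ≤ K * s ≤ K * (C i).card` vertices to `Y`, so the growth factor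
  -- is still `k - K`.
  have key : ∀ i, 2 * Fintype.card V ≤ 3 * ((C i).card + Y.card) ∨
      (k - K) ^ i * s ≤ (C i).card := by
    intro i
    induction i with
    | zero => right; simpa using hC
    | succ i ih =>
      have hsi : s ≤ (C i).card := hC.trans (Finset.card_le_card (hmono (Nat.zero_le i)))
      have hle := (Finset.card_le_card (hstep i)).trans (Finset.card_union_le _ _)
      rcases ih with ih | ih
      · left
        have := Finset.card_le_card (hmono (Nat.le_succ i))
        rw [Nat.succ_eq_add_one] at this
        omega
      rcases hE (C i) (Finset.card_pos.1 (hs.trans_le hsi)) with h | h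
      · left; omega
      · right
        obtain ⟨k', rfl⟩ := Nat.exists_eq_add_of_lt hK
        have e : K + k' + 1 - K = k' + 1 := by omega
        rw [e] at ih ⊢
        have h1 : K * s ≤ K * (C i).card := Nat.mul_le_mul_left _ hsi
        have h2 : (k' + 1) * ((k' + 1) ^ i * s) ≤ (k' + 1) * (C i).card :=
          Nat.mul_le_mul_left _ ih
        rw [pow_succ]
        nlinarith
  rcases key L with h | h
  · exact h
  · have : Fintype.card V ≤ (C L).card := by nlinarith
    omega

/-- In an expanding graph there is a short walk between two large sets of vertices, even if it has
to avoid forbidden sets whose union is not too large. -/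
theorem Expands.exists_walk [DecidableEq V] {k : ℕ} (hE : Expands G k) (P : V → V → Prop)
    (A W Y : Finset V) {K s L : ℕ} (hK : K < k) (hL : Fintype.card V ≤ (k - K) ^ L) (hs : 0 < s)
    (hsA : s ≤ A.card) (hsW : s ≤ W.card) (hY : Y.card ≤ K * s) (hYn : 6 * Y.card < Fintype.card V)
    (hAY : Disjoint A Y) (hW : ∀ w ∈ W, P w w) (hP : ∀ w ∈ W, ∀ u, ¬ P w u → u ∈ Y) :
    ∃ a ∈ A, ∃ w ∈ W, ∃ p : G.Walk a w, p.length ≤ 2 * L ∧ ∀ u ∈ p.support, P w u := by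
  -- The balls around `W` obey only the restriction `P w` of their own centre, because `w` itself
  -- may lie in `Y`. The balls around `A` avoid all of `Y`, hence suit every `w`.
  have hC := hE.card_le_of_growth (fun i => W.biUnion fun w => walkBall G (P w) w i) Y hK hL hs
    (hsW.trans (Finset.card_le_card fun w hw =>
      Finset.mem_biUnion.2 ⟨w, hw, mem_walkBall_self (hW w hw) 0⟩)) hY
    (fun i j hij => Finset.biUnion_mono fun w _ => walkBall_mono _ _ hij) (fun i v hv => by
      obtain ⟨a, ha, hav⟩ := mem_closedNbhd.1 hv
      obtain ⟨w, hw, haw⟩ := Finset.mem_biUnion.1 ha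
      by_cases hPv : P w v
      · refine Finset.mem_union_left _ (Finset.mem_biUnion.2 ⟨w, hw, ?_⟩)
        rcases hav with rfl | hav
        · exact walkBall_mono _ _ (Nat.le_succ i) haw
        · exact mem_walkBall_succ haw hav hPv
      · exact Finset.mem_union_right _ (hP w hw v hPv))
  have hD := hE.card_le_of_growth (fun i => A.biUnion fun a => walkBall G (· ∉ Y) a i) Y hK hL hs
    (hsA.trans (Finset.card_le_card fun a ha => Finset.mem_biUnion.2
      ⟨a, ha, mem_walkBall_self (P := (· ∉ Y)) (Finset.disjoint_left.1 hAY ha) 0⟩)) hY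
    (fun i j hij => Finset.biUnion_mono fun w _ => walkBall_mono _ _ hij) (fun i v hv => by
      obtain ⟨b, hb, hbv⟩ := mem_closedNbhd.1 hv
      obtain ⟨a, ha, hba⟩ := Finset.mem_biUnion.1 hb
      by_cases hPv : v ∈ Y
      · exact Finset.mem_union_right _ hPv
      · refine Finset.mem_union_left _ (Finset.mem_biUnion.2 ⟨a, ha, ?_⟩)
        rcases hbv with rfl | hbv
        · exact walkBall_mono _ _ (Nat.le_succ i) hba
        · exact mem_walkBall_succ hba hbv hPv)
  -- Both unions have more than `2/3 - 1/6 = 1/2` of the vertices, so they meet.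
  obtain ⟨u, hu⟩ : ((W.biUnion fun w => walkBall G (P w) w L) ∩
      (A.biUnion fun a => walkBall G (· ∉ Y) a L)).Nonempty := by
    rw [← Finset.card_pos]
    have h1 := Finset.card_union_add_card_inter (W.biUnion fun w => walkBall G (P w) w L)
      (A.biUnion fun a => walkBall G (· ∉ Y) a L)
    have h2 := Finset.card_le_univ ((W.biUnion fun w => walkBall G (P w) w L) ∪
      (A.biUnion fun a => walkBall G (· ∉ Y) a L))
    omega
  rw [Finset.mem_inter, Finset.mem_biUnion, Finset.mem_biUnion] at hu
  obtain ⟨⟨w, hw, hu1⟩, a, ha, hu2⟩ := hu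
  obtain ⟨p, hp1, hp2⟩ := mem_walkBall.1 hu1
  obtain ⟨q, hq1, hq2⟩ := mem_walkBall.1 hu2
  refine ⟨a, ha, w, hw, q.reverse.append p, ?_, fun x hx => ?_⟩
  · rw [SimpleGraph.Walk.length_append, SimpleGraph.Walk.length_reverse]; omega
  · rw [SimpleGraph.Walk.mem_support_append_iff, SimpleGraph.Walk.support_reverse,
      List.mem_reverse] at hx
    rcases hx with hx | hx
    · by_contra hcon
      exact hq2 x hx (hP w hw x hcon)
    · exact hp2 x hx

/-- If `n` vertices carry `n` pebbles, at most `M` each, then the empty vertices are at most `M`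
times as many as the vertices with two pebbles. -/
theorem card_filter_zero_le (φ : V → ℕ) (hφ : ∑ v, φ v = Fintype.card V) {M : ℕ}
    (hM : ∀ v, φ v ≤ M) :
    (Finset.univ.filter fun v => φ v = 0).card ≤
      M * (Finset.univ.filter fun v => 2 ≤ φ v).card := by
  have h : ∑ v, (φ v + if φ v = 0 then 1 else 0) ≤ ∑ v, (1 + M * if 2 ≤ φ v then 1 else 0) := by
    refine Finset.sum_le_sum fun v _ => ?_
    have := hM v
    split_ifs <;> omega
  rw [Finset.sum_add_distrib, Finset.sum_add_distrib, ← Finset.mul_sum, ← Finset.card_filter,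
    ← Finset.card_filter, hφ] at h
  simpa using h

/-- A graph that expands sufficiently is Class 0. -/
theorem Expands.isClassZero {k L M c : ℕ} (hE : Expands G k) (hM : M = 2 ^ (2 * L))
    (hc : c = M * (2 * L + 1)) (hL0 : 0 < L) (hk : 6 * (c * (4 * M + 1)) < k)
    (hL : Fintype.card V ≤ (k - c * (4 * M + 1)) ^ L) (hkn : 3 * k ≤ 2 * Fintype.card V) :
    IsClassZero G := by
  classical
  set K := c * (4 * M + 1) with hKdef
  have hM0 : 0 < M := by rw [hM]; positivity
  have hc0 : 0 < c := by rw [hc]; positivity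
  have hKk : K < k := by omega
  have hKn : 6 * K < Fintype.card V := by omega
  have hdiam : ∀ v w, ∃ p : G.Walk v w, p.length ≤ 2 * L := fun v w => by
    obtain ⟨a, ha, b, hb, p, hp, -⟩ := hE.exists_walk (fun _ _ => True) {v} {w} ∅ (s := 1)
      (L := L) hKk hL one_pos (by simp) (by simp) (by simp) (by simp; omega) (by simp) (by simp)
      (by simp)
    rw [Finset.mem_singleton] at ha hb
    subst ha hb
    exact ⟨p, hp⟩
  have hlarge : ∀ φ : V → ℕ, ∀ v w, M ≤ φ v → PotentialToPebble G φ w := fun φ v w h => by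
    obtain ⟨p, hp⟩ := hdiam v w
    exact potentialToPebble_of_walk p φ
      ((Nat.pow_le_pow_right (by norm_num) hp).trans (hM ▸ h))
  refine isClassZero_iff.2 fun φ hφ r => ?_
  by_contra hr
  have hφM : ∀ v, φ v ≤ M := fun v => by
    by_contra h
    exact hr (hlarge φ v r (by omega))
  have hr0 : φ r = 0 := by
    by_contra h
    exact hr ⟨φ, .refl, Nat.pos_of_ne_zero h⟩
  have hzh := card_filter_zero_le φ hφ hφM
  set Z := Finset.univ.filter fun v => φ v = 0 with hZ
  set H := Finset.univ.filter fun v => 2 ≤ φ v with hH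
  have hrZ : r ∈ Z := by simp [hZ, hr0]
  have hHZ : Disjoint H Z := by
    rw [Finset.disjoint_left]
    intro v hv hv'
    simp only [hH, hZ, Finset.mem_filter] at hv hv'
    omega
  have hZ0 : 0 < Z.card := Finset.card_pos.2 ⟨r, hrZ⟩
  have hH0 : 0 < H.card := Nat.pos_of_mul_pos_left (hZ0.trans_le hzh)
  -- If at most `K` vertices are empty, expansion from single vertices (`s = 1`) already gets around
  -- them.
  by_cases hZK : Z.card ≤ K
  · obtain ⟨v, hv, w, hw, p, -, hp⟩ := hE.exists_walk (fun _ u => u = r ∨ φ u ≠ 0) H {r}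
      (Z.erase r) (s := 1) (L := L) hKk hL one_pos hH0 (by simp)
      (by have := Finset.card_erase_le (s := Z) (a := r); omega)
      (by have := Finset.card_erase_le (s := Z) (a := r); omega)
      (hHZ.mono_right (Finset.erase_subset _ _)) (by simp) (by simp [hZ])
    rw [Finset.mem_singleton] at hw
    subst hw
    have hv2 : 2 ≤ φ v := (Finset.mem_filter.1 hv).2
    obtain ⟨ψ, h1, h2, -⟩ := exists_reflTransGen_path p.bypass p.bypass_isPath
      (by rintro rfl; omega) φ hv2 fun u hu huw => by
        rcases hp u (p.support_bypass_subset_support hu) with h | h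
        · exact absurd h huw
        · omega
    exact hr ⟨ψ, h1, by omega⟩
  push Not at hZK
  have hblock : ∀ w, ∃ X : Finset V, X.card ≤ c ∧ w ∉ X ∧ ∀ v, 2 ≤ φ v → v ≠ w →
      ∀ p : G.Walk v w, p.length ≤ 2 * L → ∃ u ∈ p.support, u ≠ w ∧ (φ u = 0 ∨ u ∈ X) := by
    intro w
    rcases exists_reflTransGen_or_blocked G φ w (2 * L) M with ⟨ψ, h1, h2⟩ | h
    · exact absurd ((hlarge ψ w r h2).of_reflTransGen h1) hr
    · rwa [hc]
  choose X hX1 hX2 hX3 using hblock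
  -- No vertex has more than `c` neighbours with two pebbles.
  have hdeg : ∀ w, (H.filter fun v => G.Adj v w).card ≤ c := fun w => by
    refine (Finset.card_le_card fun v hv => ?_).trans (hX1 w)
    obtain ⟨hv1, hv2⟩ := Finset.mem_filter.1 hv
    have hv3 : 2 ≤ φ v := (Finset.mem_filter.1 hv1).2
    obtain ⟨u, hu, huw, h⟩ := hX3 w v hv3 hv2.ne (.cons hv2 .nil) (by simp; omega)
    have : u = v := by simpa [huw] using hu
    subst this
    exact h.resolve_left (by omega)
  -- Double counting of adjacencies with `H`: expansion of singletons makes all degrees at least `k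
  -- - 1`.
  have hHk : H.card * (k - 1) ≤ c * Fintype.card V := by
    have h1 : ∀ v, k - 1 ≤ (Finset.univ.filter fun w => G.Adj v w).card := fun v => by
      have h2 : k ≤ (closedNbhd G {v}).card := by
        rcases hE {v} (by simp) with h | h
        · omega
        · simpa using h
      have h3 : closedNbhd G {v} ⊆ insert v (Finset.univ.filter fun w => G.Adj v w) := by
        intro u hu
        obtain ⟨a, ha, hau⟩ := mem_closedNbhd.1 hu
        rw [Finset.mem_singleton] at ha
        subst ha
        rcases hau with rfl | hau
        · simp
        · simp [hau]
      have := (Finset.card_le_card h3).trans (Finset.card_insert_le _ _)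
      omega
    calc H.card * (k - 1) ≤ ∑ v ∈ H, (Finset.univ.filter fun w => G.Adj v w).card := by
          rw [← smul_eq_mul]
          exact Finset.card_nsmul_le_sum _ _ _ fun v _ => h1 v
      _ = ∑ w, (H.filter fun v => G.Adj v w).card :=
          Finset.sum_card_bipartiteAbove_eq_sum_card_bipartiteBelow _
      _ ≤ Fintype.card V • c := Finset.sum_le_card_nsmul _ _ _ fun w _ => hdeg w
      _ = c * Fintype.card V := by rw [smul_eq_mul, mul_comm]
  have hMc : 1 ≤ M * c := Nat.mul_pos hM0 hc0
  have hHn : 6 * ((M + 1) * H.card) < Fintype.card V := by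
    have h1 : 6 * (M + 1) * c < k - 1 := by
      have : 6 * K = 24 * (M * c) + 6 * c := by rw [hKdef]; ring
      have : 6 * (M + 1) * c = 6 * (M * c) + 6 * c := by ring
      omega
    have h2 : 6 * (M + 1) * (H.card * (k - 1)) ≤ 6 * (M + 1) * (c * Fintype.card V) :=
      Nat.mul_le_mul_left _ hHk
    have h3 : 6 * (M + 1) * c * Fintype.card V < (k - 1) * Fintype.card V :=
      Nat.mul_lt_mul_of_pos_right h1 (by omega)
    refine lt_of_mul_lt_mul_left (a := k - 1) ?_ (Nat.zero_le _)
    nlinarith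
  have hHc : 4 * c ≤ H.card := by
    have h1 : M * (4 * c) ≤ M * H.card := by
      have : K = M * (4 * c) + c := by rw [hKdef]; ring
      omega
    exact le_of_mul_le_mul_left h1 hM0
  -- For `s` vertices `w` the sets `X w` cover at most `c * s` vertices, at most half of `H`.
  -- Conversely `H.card ≤ 4 * c * s`, so `Z` and these sets have at most `4 * M * c * s + c * s = K
  -- * s` vertices; this dictates `K`.
  obtain ⟨s, hs1, hs2⟩ : ∃ s, 2 * c * s ≤ H.card ∧ H.card < 2 * c * (s + 1) :=
    ⟨H.card / (2 * c), Nat.mul_div_le _ _, Nat.lt_mul_div_succ _ (by omega)⟩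
  have hs0 : 0 < s := by
    by_contra h
    have : s = 0 := by omega
    subst this
    omega
  have hcs : c ≤ c * s := Nat.le_mul_of_pos_right _ hs0
  have hscs : s ≤ c * s := Nat.le_mul_of_pos_left _ hc0
  have hs3 : 2 * (c * s) ≤ H.card := by rw [← mul_assoc]; exact hs1
  have hs4 : H.card ≤ 4 * (c * s) := by nlinarith
  have hMH : (M + 1) * H.card = M * H.card + H.card := by ring
  -- Outside `Z`, so that walks may end at `w`; outside `H`, so that a walk from `H` does not start
  -- there.
  obtain ⟨W, hWsub, hWs⟩ := Finset.exists_subset_card_eq (s := (Z ∪ H)ᶜ) (n := s) (by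
    rw [Finset.card_compl]
    have := Finset.card_union_le Z H
    omega)
  have hWφ : ∀ w ∈ W, φ w ≠ 0 := fun w hw h => by
    have := hWsub hw
    simp [hZ, h] at this
  have hXc : (W.biUnion X).card ≤ c * s := by
    rw [mul_comm, ← hWs]
    exact Finset.card_biUnion_le_card_mul _ _ _ fun w _ => hX1 w
  obtain ⟨v, hv, w, hw, p, hp1, hp2⟩ := hE.exists_walk (fun w u => φ u ≠ 0 ∧ u ∉ X w)
    (H \ W.biUnion X) W (Z ∪ W.biUnion X) (s := s) hKk hL hs0
    (by have := Finset.le_card_sdiff (W.biUnion X) H; omega) hWs.ge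
    (by
      have h1 := Finset.card_union_le Z (W.biUnion X)
      have h2 : M * H.card ≤ M * (4 * (c * s)) := Nat.mul_le_mul_left _ hs4
      have h3 : K * s = M * (4 * (c * s)) + c * s := by rw [hKdef]; ring
      omega)
    (by
      have h1 := Finset.card_union_le Z (W.biUnion X)
      omega)
    (by
      rw [Finset.disjoint_union_right]
      exact ⟨hHZ.mono_left Finset.sdiff_subset, Finset.sdiff_disjoint⟩)
    (fun w hw => ⟨hWφ w hw, hX2 w⟩)
    (fun w hw u hu => by
      by_cases hu0 : φ u = 0
      · exact Finset.mem_union_left _ (by simp [hZ, hu0])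
      · refine Finset.mem_union_right _ (Finset.mem_biUnion.2 ⟨w, hw, ?_⟩)
        by_contra h
        exact hu ⟨hu0, h⟩)
  have hv' := (Finset.mem_sdiff.1 hv).1
  obtain ⟨u, hu, -, h⟩ := hX3 w v (Finset.mem_filter.1 hv').2 (by
    rintro rfl
    have := hWsub hw
    simp only [Finset.mem_compl, Finset.mem_union, not_or] at this
    exact this.2 hv') p hp1
  exact h.elim (hp2 u hu).1 (hp2 u hu).2

end Pebbling

/-! ### Random subsets as polynomials in the probability. -/

namespace Pebbling

section BernSum

variable {α : Type*}

/-- The expectation of `f S` for a random subset `S` of `U` that contains each element of `U`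
independently with probability `p`. -/
noncomputable def bernSum (U : Finset α) (p : ℝ) (f : Finset α → ℝ) : ℝ :=
  ∑ S ∈ U.powerset, p ^ S.card * (1 - p) ^ (U.card - S.card) * f S

theorem bernSum_one (U : Finset α) (p : ℝ) : bernSum U p (fun _ => 1) = 1 := by
  simp [bernSum, Finset.sum_pow_mul_eq_add_pow]

theorem bernSum_const_mul (U : Finset α) (p c : ℝ) (f : Finset α → ℝ) :
    bernSum U p (fun S => c * f S) = c * bernSum U p f := by
  simp only [bernSum, Finset.mul_sum]
  exact Finset.sum_congr rfl fun S _ => by ring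

theorem bernSum_mul_const (U : Finset α) (p c : ℝ) (f : Finset α → ℝ) :
    bernSum U p (fun S => f S * c) = bernSum U p f * c := by
  simp only [bernSum, Finset.sum_mul]
  exact Finset.sum_congr rfl fun S _ => by ring

theorem bernSum_add (U : Finset α) (p : ℝ) (f g : Finset α → ℝ) :
    bernSum U p (fun S => f S + g S) = bernSum U p f + bernSum U p g := by
  simp only [bernSum, mul_add, Finset.sum_add_distrib]

theorem bernSum_mono (U : Finset α) {p : ℝ} (hp : p ∈ Set.Icc (0 : ℝ) 1) {f g : Finset α → ℝ}
    (h : ∀ S, f S ≤ g S) : bernSum U p f ≤ bernSum U p g := by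
  have h1 : 0 ≤ 1 - p := sub_nonneg.2 hp.2
  have h0 : 0 ≤ p := hp.1
  exact Finset.sum_le_sum fun S _ => mul_le_mul_of_nonneg_left (h S) (by positivity)

theorem continuous_bernSum (U : Finset α) (f : Finset α → ℝ) :
    Continuous fun p => bernSum U p f := by
  unfold bernSum
  fun_prop

variable [DecidableEq α]

theorem bernSum_insert {a : α} {U : Finset α} (ha : a ∉ U) (p : ℝ) (f : Finset α → ℝ) :
    bernSum (insert a U) p f =
      (1 - p) * bernSum U p f + p * bernSum U p (fun S => f (insert a S)) := by
  unfold bernSum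
  rw [Finset.sum_powerset_insert ha, Finset.mul_sum, Finset.mul_sum]
  congr 1
  · refine Finset.sum_congr rfl fun S hS => ?_
    have := Finset.card_le_card (Finset.mem_powerset.1 hS)
    rw [Finset.card_insert_of_notMem ha, Nat.succ_sub this, pow_succ]
    ring
  · refine Finset.sum_congr rfl fun S hS => ?_
    have haS : a ∉ S := fun h => ha (Finset.mem_powerset.1 hS h)
    rw [Finset.card_insert_of_notMem ha, Finset.card_insert_of_notMem haS, Nat.add_sub_add_right,
      pow_succ]
    ring

/-- The union of independent random subsets is a random subset. -/
theorem bernSum_bernSum_union (U : Finset α) (p q : ℝ) (f : Finset α → ℝ) :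
    bernSum U (1 - (1 - p) * (1 - q)) f =
      bernSum U p fun S => bernSum U q fun T => f (S ∪ T) := by
  induction U using Finset.induction_on generalizing f with
  | empty => simp [bernSum]
  | insert a U ha ih =>
    simp only [bernSum_insert ha, ih, bernSum_add, bernSum_const_mul, Finset.insert_union,
      Finset.union_insert, Finset.insert_idem]
    ring

/-- The factor for `W` splits off, and the weights of the subsets of `U \ W` sum to 1. -/
theorem bernSum_disjoint {U W : Finset α} (hW : W ⊆ U) (p : ℝ) :
    bernSum U p (fun S => if Disjoint S W then 1 else 0) = (1 - p) ^ W.card := by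
  have hf : U.powerset.filter (fun S => Disjoint S W) = (U \ W).powerset := by
    ext S
    simp [Finset.subset_sdiff]
  simp only [bernSum, mul_ite, mul_one, mul_zero]
  rw [← Finset.sum_filter, hf]
  have hc : U.card = W.card + (U \ W).card := by
    rw [Finset.card_sdiff_of_subset hW]
    have := Finset.card_le_card hW
    omega
  calc _ = ∑ S ∈ (U \ W).powerset,
        (1 - p) ^ W.card * (p ^ S.card * (1 - p) ^ ((U \ W).card - S.card)) := by
        refine Finset.sum_congr rfl fun S hS => ?_
        have := Finset.card_le_card (Finset.mem_powerset.1 hS)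
        rw [hc, Nat.add_sub_assoc this, pow_add]
        ring
    _ = _ := by
        rw [← Finset.mul_sum, Finset.sum_pow_mul_eq_add_pow]
        simp

/-- A decreasing event holds for a union of independent random sets with at most the product of
its probabilities for the two sets. -/
theorem bernSum_union_le (U : Finset α) {p q : ℝ} (hp : p ∈ Set.Icc (0 : ℝ) 1)
    (hq : q ∈ Set.Icc (0 : ℝ) 1) {Q : Finset α → Prop} [DecidablePred Q] (hQ : Antitone Q) :
    bernSum U (1 - (1 - p) * (1 - q)) (fun S => if Q S then 1 else 0) ≤
      bernSum U p (fun S => if Q S then 1 else 0) *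
        bernSum U q (fun S => if Q S then 1 else 0) := by
  rw [bernSum_bernSum_union, ← bernSum_mul_const]
  refine bernSum_mono U hp fun S => ?_
  rw [← bernSum_const_mul]
  refine bernSum_mono U hq fun T => ?_
  by_cases h : Q (S ∪ T)
  · have h1 : Q S := hQ Finset.subset_union_left h
    have h2 : Q T := hQ Finset.subset_union_right h
    simp [h, h1, h2]
  · simp only [h, if_false]
    split_ifs <;> simp

end BernSum

/-! ### Random graphs and their expansion. -/

section Graph

variable {V : Type*} [Fintype V]

theorem measurableSingletonClass_simpleGraph : MeasurableSingletonClass (SimpleGraph V) where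
  measurableSet_singleton G := by
    have h : {G} = SimpleGraph.edgeSet ⁻¹' {G.edgeSet} := by
      ext H
      simp
    rw [h]
    exact SimpleGraph.measurableEmbedding_edgeSet.measurable (measurableSet_singleton _)

open Classical in
theorem binomialRandom_real_eq (p : unitInterval) (Q : SimpleGraph V → Prop) :
    (SimpleGraph.binomialRandom V p).real {G | Q G} =
      bernSum (⊤ : SimpleGraph V).edgeFinset p
        (fun S => if Q (SimpleGraph.fromEdgeSet S) then 1 else 0) := by
  have := measurableSingletonClass_simpleGraph (V := V)
  have hset : {G : SimpleGraph V | Q G} = ((Finset.univ.filter Q : Finset (SimpleGraph V)) :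
      Set (SimpleGraph V)) := by simp
  rw [hset, ← MeasureTheory.sum_measureReal_singleton]
  simp only [bernSum, mul_ite, mul_one, mul_zero]
  rw [← Finset.sum_filter]
  refine Finset.sum_bij' (fun G _ => G.edgeFinset) (fun S _ => SimpleGraph.fromEdgeSet S)
    ?_ ?_ ?_ ?_ ?_
  · intro G hG
    refine Finset.mem_filter.2 ⟨Finset.mem_powerset.2
      (SimpleGraph.edgeFinset_subset_edgeFinset.2 le_top), ?_⟩
    simpa using hG
  · intro S hS
    simpa using (Finset.mem_filter.1 hS).2
  · intro G hG
    simp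
  · intro S hS
    have hS' := Finset.mem_powerset.1 (Finset.mem_filter.1 hS).1
    ext e
    simp only [SimpleGraph.mem_edgeFinset, SimpleGraph.edgeSet_fromEdgeSet, Set.mem_sdiff,
      Finset.mem_coe, and_iff_left_iff_imp]
    intro he
    have := hS' he
    simpa using this
  · intro G hG
    rw [MeasureTheory.measureReal_def, SimpleGraph.binomialRandom_singleton,
      Set.ncard_eq_toFinset_card', SimpleGraph.card_edgeFinset_top_eq_card_choose_two]
    simp [Nat.card_eq_fintype_card, SimpleGraph.edgeFinset]

theorem binomialRandom_real_noEdges_le (p : unitInterval) {A B : Finset V} (h : Disjoint A B) :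
    (SimpleGraph.binomialRandom V p).real {G | ∀ a ∈ A, ∀ b ∈ B, ¬ G.Adj a b} ≤
      (1 - (p : ℝ)) ^ (A.card * B.card) := by
  classical
  rw [binomialRandom_real_eq]
  have hne : ∀ a ∈ A, ∀ b ∈ B, a ≠ b := fun a ha b hb hab =>
    Finset.disjoint_left.1 h ha (hab ▸ hb)
  have hW : (A ×ˢ B).image (fun x => s(x.1, x.2)) ⊆ (⊤ : SimpleGraph V).edgeFinset := by
    intro e he
    obtain ⟨⟨a, b⟩, hab, rfl⟩ := Finset.mem_image.1 he
    obtain ⟨ha, hb⟩ := Finset.mem_product.1 hab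
    simpa using hne a ha b hb
  have hcard : ((A ×ˢ B).image (fun x => s(x.1, x.2))).card = A.card * B.card := by
    rw [Finset.card_image_of_injOn, Finset.card_product]
    rintro ⟨a, b⟩ hab ⟨a', b'⟩ hab' heq
    simp only [Finset.coe_product, Set.mem_prod, Finset.mem_coe] at hab hab'
    rcases Sym2.eq_iff.1 heq with ⟨h1, h2⟩ | ⟨h1, h2⟩
    · exact Prod.ext h1 h2
    · exact absurd h1 (hne a hab.1 b' hab'.2)
  rw [← hcard, ← bernSum_disjoint hW]
  refine bernSum_mono _ p.2 fun S => ?_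
  by_cases hS : ∀ a ∈ A, ∀ b ∈ B, ¬ (SimpleGraph.fromEdgeSet (S : Set (Sym2 V))).Adj a b
  · have : Disjoint S ((A ×ˢ B).image (fun x => s(x.1, x.2))) := by
      rw [Finset.disjoint_right]
      intro e he heS
      obtain ⟨⟨a, b⟩, hab, rfl⟩ := Finset.mem_image.1 he
      obtain ⟨ha, hb⟩ := Finset.mem_product.1 hab
      exact hS a ha b hb ⟨heS, hne a ha b hb⟩
    rw [if_pos hS, if_pos this]
  · rw [if_neg hS]
    split_ifs <;> simp

/-- Random graphs of average degree well above `k log n` expand by the factor `k`. -/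
theorem binomialRandom_real_not_expands_le (p : unitInterval) (k : ℕ) (hV : 0 < Fintype.card V)
    (hp : 3 * ((k + 2) * Real.log (Fintype.card V)) ≤ p * Fintype.card V) :
    (SimpleGraph.binomialRandom V p).real {G | ¬ Expands G k} ≤
      Real.exp 2 / Fintype.card V := by
  classical
  set n := Fintype.card V with hn
  have hn0 : (0 : ℝ) < n := by exact_mod_cast hV
  have hn1 : (1 : ℝ) ≤ n := by exact_mod_cast hV
  have hlog : 0 ≤ Real.log n := Real.log_nonneg hn1
  -- The second set of a pair stands for the closed neighbourhood of the first, which has no edge to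
  -- its complement.
  set I : Finset (Finset V × Finset V) := Finset.univ.filter fun x =>
    x.1.Nonempty ∧ x.1 ⊆ x.2 ∧ 3 * x.2.card < 2 * n ∧ x.2.card < k * x.1.card with hI
  have hsub : {G : SimpleGraph V | ¬ Expands G k} ⊆
      ⋃ x ∈ I, {G | ∀ a ∈ x.1, ∀ b ∈ x.2ᶜ, ¬ G.Adj a b} := by
    intro G hG
    simp only [Expands, Set.mem_ofPred_eq, not_forall, not_or, not_le] at hG
    obtain ⟨A, hA, h1, h2⟩ := hG
    simp only [Set.mem_iUnion]
    refine ⟨(A, closedNbhd G A), by simp [hI, hA, h1, h2, subset_closedNbhd, hn], ?_⟩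
    intro a ha b hb hab
    exact Finset.mem_compl.1 hb (mem_closedNbhd.2 ⟨a, ha, .inr hab⟩)
  have hterm : ∀ x ∈ I, (SimpleGraph.binomialRandom V p).real
      {G | ∀ a ∈ x.1, ∀ b ∈ x.2ᶜ, ¬ G.Adj a b} ≤
      (n : ℝ)⁻¹ * ((n : ℝ)⁻¹ ^ x.1.card * (n : ℝ)⁻¹ ^ x.2.card) := by
    rintro ⟨A, S⟩ hx
    simp only [hI, Finset.mem_filter, Finset.mem_univ, true_and] at hx
    obtain ⟨hA, hAS, hS1, hS2⟩ := hx
    have hd : Disjoint A Sᶜ := Finset.disjoint_left.2 fun a ha ha' =>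
      Finset.mem_compl.1 ha' (hAS ha)
    refine (binomialRandom_real_noEdges_le p hd).trans ?_
    have hA1 : (1 : ℝ) ≤ A.card := by exact_mod_cast hA.card_pos
    have hSc : (n : ℝ) / 3 ≤ (Sᶜ.card : ℝ) := by
      rw [Finset.card_compl, Nat.cast_sub (Finset.card_le_univ S), ← hn]
      have : (3 * S.card : ℝ) < 2 * n := by exact_mod_cast hS1
      linarith
    have hSk : (S.card : ℝ) ≤ k * A.card := by exact_mod_cast hS2.le
    have hp0 : (0 : ℝ) ≤ p := p.2.1
    have hinv : (n : ℝ)⁻¹ = Real.exp (-Real.log n) := by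
      rw [Real.exp_neg, Real.exp_log hn0]
    calc (1 - (p : ℝ)) ^ (A.card * Sᶜ.card)
        ≤ Real.exp (-p) ^ (A.card * Sᶜ.card) :=
          pow_le_pow_left₀ (sub_nonneg.2 p.2.2) (Real.one_sub_le_exp_neg _) _
      _ = Real.exp (-(A.card * (p * Sᶜ.card))) := by
          rw [← Real.exp_nat_mul]
          congr 1
          push_cast
          ring
      -- The complement of `S` has at least `n / 3` vertices, and `1 + |A| + |S| ≤ |A| * (k + 2)`.
      -- The resulting power of `1 / n` pays for the choice of `A` and of `S`, with one factor to
      -- spare.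
      _ ≤ Real.exp (-((1 + A.card + S.card) * Real.log n)) := by
          rw [Real.exp_le_exp, neg_le_neg_iff]
          calc (1 + A.card + S.card) * Real.log n
              ≤ (A.card * (k + 2)) * Real.log n :=
                mul_le_mul_of_nonneg_right (by nlinarith) hlog
            _ = A.card * ((k + 2) * Real.log n) := by ring
            _ ≤ A.card * (p * Sᶜ.card) := by
                refine mul_le_mul_of_nonneg_left ?_ (by positivity)
                nlinarith
      _ = _ := by
          rw [hinv, ← Real.exp_nat_mul, ← Real.exp_nat_mul, ← Real.exp_add, ← Real.exp_add]
          congr 1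
          ring
  have hsum : ∑ A : Finset V, (n : ℝ)⁻¹ ^ A.card ≤ Real.exp 1 := by
    have h1 : ∑ A : Finset V, (n : ℝ)⁻¹ ^ A.card = ((n : ℝ)⁻¹ + 1) ^ n := by
      rw [hn, ← Finset.card_univ, ← Finset.sum_pow_mul_eq_add_pow, Finset.powerset_univ]
      simp
    rw [h1]
    calc ((n : ℝ)⁻¹ + 1) ^ n ≤ Real.exp ((n : ℝ)⁻¹) ^ n :=
          pow_le_pow_left₀ (by positivity) (Real.add_one_le_exp _) _
      _ = Real.exp 1 := by
          rw [← Real.exp_nat_mul, mul_inv_cancel₀ hn0.ne']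
  calc (SimpleGraph.binomialRandom V p).real {G | ¬ Expands G k}
      ≤ (SimpleGraph.binomialRandom V p).real
          (⋃ x ∈ I, {G | ∀ a ∈ x.1, ∀ b ∈ x.2ᶜ, ¬ G.Adj a b}) :=
        MeasureTheory.measureReal_mono hsub (MeasureTheory.measure_ne_top _ _)
    _ ≤ ∑ x ∈ I, (SimpleGraph.binomialRandom V p).real
          {G | ∀ a ∈ x.1, ∀ b ∈ x.2ᶜ, ¬ G.Adj a b} :=
        MeasureTheory.measureReal_biUnion_finset_le _ _
    _ ≤ ∑ x ∈ I, (n : ℝ)⁻¹ * ((n : ℝ)⁻¹ ^ x.1.card * (n : ℝ)⁻¹ ^ x.2.card) :=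
        Finset.sum_le_sum hterm
    _ ≤ ∑ x : Finset V × Finset V, (n : ℝ)⁻¹ * ((n : ℝ)⁻¹ ^ x.1.card * (n : ℝ)⁻¹ ^ x.2.card) :=
        Finset.sum_le_sum_of_subset_of_nonneg (Finset.subset_univ _) fun _ _ _ => by positivity
    _ = (n : ℝ)⁻¹ * ((∑ A : Finset V, (n : ℝ)⁻¹ ^ A.card) *
          ∑ A : Finset V, (n : ℝ)⁻¹ ^ A.card) := by
        rw [← Finset.mul_sum, Fintype.sum_prod_type, Finset.sum_mul_sum]
    _ ≤ (n : ℝ)⁻¹ * (Real.exp 1 * Real.exp 1) := by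
        have : 0 ≤ ∑ A : Finset V, (n : ℝ)⁻¹ ^ A.card :=
          Finset.sum_nonneg fun _ _ => by positivity
        gcongr
    _ = Real.exp 2 / n := by
        rw [← Real.exp_add]
        norm_num
        ring

end Graph

end Pebbling

namespace Pebbling

/-! ### Thresholds of monotone properties. -/

section Threshold

section Finset

variable {α : Type*} {U : Finset α} {Q : Finset α → Prop} [DecidablePred Q]

theorem bernSum_zero_left (U : Finset α) (f : Finset α → ℝ) : bernSum U 0 f = f ∅ := by
  rw [bernSum, Finset.sum_eq_single ∅]
  · simp
  · intro S _ hS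
    simp [hS]
  · simp

theorem bernSum_one_left (U : Finset α) (f : Finset α → ℝ) : bernSum U 1 f = f U := by
  rw [bernSum, Finset.sum_eq_single U]
  · simp
  · intro S hS hSU
    have : S.card < U.card :=
      Finset.card_lt_card ((Finset.mem_powerset.1 hS).ssubset_of_ne hSU)
    rw [sub_self, zero_pow (by omega)]
    simp
  · simp

theorem bernSum_ite_nonneg {p : ℝ} (hp : p ∈ Set.Icc (0 : ℝ) 1) :
    0 ≤ bernSum U p (fun S => if Q S then 1 else 0) := by
  have h : bernSum U p (fun _ => 0) = 0 := by simp [bernSum]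
  exact h.ge.trans (bernSum_mono U hp fun S => by split_ifs <;> simp)

theorem bernSum_ite_le_one {p : ℝ} (hp : p ∈ Set.Icc (0 : ℝ) 1) :
    bernSum U p (fun S => if Q S then 1 else 0) ≤ 1 :=
  (bernSum_mono U hp fun S => by split_ifs <;> simp).trans (bernSum_one U p).le

variable [DecidableEq α]

theorem bernSum_antitone (hQ : Antitone Q) {p r : ℝ} (hp : 0 ≤ p) (hpr : p ≤ r) (hr : r ≤ 1) :
    bernSum U r (fun S => if Q S then 1 else 0) ≤
      bernSum U p (fun S => if Q S then 1 else 0) := by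
  rcases (hpr.trans hr).eq_or_lt with h1 | h1
  · rw [le_antisymm (h1 ▸ hr) hpr]
  · have h0 : 0 < 1 - p := sub_pos.2 h1
    have hq : (r - p) / (1 - p) ∈ Set.Icc (0 : ℝ) 1 :=
      ⟨div_nonneg (sub_nonneg.2 hpr) h0.le, (div_le_one h0).2 (by linarith)⟩
    -- Coupling: a random set of density `r` is the union of one of density `p` and an independent
    -- one.
    have e : r = 1 - (1 - p) * (1 - (r - p) / (1 - p)) := by
      field_simp
      ring
    have h := bernSum_union_le U ⟨hp, h1.le⟩ hq hQ
    rw [← e] at h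
    exact h.trans (mul_le_of_le_one_right (bernSum_ite_nonneg ⟨hp, h1.le⟩)
      (bernSum_ite_le_one hq))

theorem one_sub_pow_mem_Icc {p : ℝ} (hp : p ∈ Set.Icc (0 : ℝ) 1) (k : ℕ) :
    1 - (1 - p) ^ k ∈ Set.Icc (0 : ℝ) 1 := by
  have h0 : 0 ≤ 1 - p := sub_nonneg.2 hp.2
  have h1 : (1 - p) ^ k ≤ 1 := pow_le_one₀ h0 (by linarith [hp.1])
  have h2 : 0 ≤ (1 - p) ^ k := pow_nonneg h0 k
  exact ⟨by linarith, by linarith⟩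

theorem bernSum_one_sub_pow_le (hQ : Antitone Q) {p : ℝ} (hp : p ∈ Set.Icc (0 : ℝ) 1) (k : ℕ) :
    bernSum U (1 - (1 - p) ^ k) (fun S => if Q S then 1 else 0) ≤
      bernSum U p (fun S => if Q S then 1 else 0) ^ k := by
  induction k with
  | zero => simpa using bernSum_ite_le_one (U := U) (Q := Q) (p := 0) (by simp)
  | succ k ih =>
    have h := bernSum_union_le U (one_sub_pow_mem_Icc hp k) hp hQ
    rw [sub_sub_cancel, ← pow_succ] at h
    rw [pow_succ _ k]
    exact h.trans (mul_le_mul_of_nonneg_right ih (bernSum_ite_nonneg hp))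

/-- Multiplying the probability by `k` raises the probability of a decreasing event at most to
the power `k`. -/
theorem bernSum_le_pow_of_mul_le (hQ : Antitone Q) {p r : ℝ} (hp : p ∈ Set.Icc (0 : ℝ) 1)
    (hr : r ≤ 1) {k : ℕ} (hk : k * p ≤ r) :
    bernSum U r (fun S => if Q S then 1 else 0) ≤
      bernSum U p (fun S => if Q S then 1 else 0) ^ k := by
  refine le_trans (bernSum_antitone hQ (one_sub_pow_mem_Icc hp k).1 ?_ hr)
    (bernSum_one_sub_pow_le hQ hp k)
  have h := one_add_mul_le_pow (a := -p) (by linarith [hp.2]) k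
  rw [← sub_eq_add_neg] at h
  linarith

end Finset

variable (P : ∀ n : ℕ, SimpleGraph (Fin n) → Prop)

open Classical in
/-- The probability that the random graph does not have the property `P`, for any real `x`. -/
noncomputable def failProb (n : ℕ) (x : ℝ) : ℝ :=
  bernSum (⊤ : SimpleGraph (Fin n)).edgeFinset x
    (fun S => if ¬ P n (SimpleGraph.fromEdgeSet S) then 1 else 0)

theorem prob_eq (n : ℕ) (p : unitInterval) : prob P n p = 1 - failProb P n p := by
  classical
  have h : prob P n p = bernSum (⊤ : SimpleGraph (Fin n)).edgeFinset p
      (fun S => if P n (SimpleGraph.fromEdgeSet S) then 1 else 0) := by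
    rw [prob, binomialRandom_real_eq]
    congr!
  rw [h, failProb, eq_sub_iff_add_eq, ← bernSum_add]
  refine Eq.trans ?_ (bernSum_one (⊤ : SimpleGraph (Fin n)).edgeFinset p)
  congr 1
  funext S
  split_ifs <;> simp_all

variable {P}

theorem antitone_not_fromEdgeSet {n : ℕ} (hP : Monotone (P n)) :
    Antitone fun S : Finset (Sym2 (Fin n)) => ¬ P n (SimpleGraph.fromEdgeSet S) :=
  fun _ _ h hT hS => hT (hP (SimpleGraph.fromEdgeSet_mono (Finset.coe_subset.2 h)) hS)

theorem failProb_le_pow_of_mul_le {n : ℕ} (hP : Monotone (P n)) {p r : ℝ}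
    (hp : p ∈ Set.Icc (0 : ℝ) 1) (hr : r ≤ 1) {k : ℕ} (hk : k * p ≤ r) :
    failProb P n r ≤ failProb P n p ^ k := by
  classical
  exact bernSum_le_pow_of_mul_le (antitone_not_fromEdgeSet hP) hp hr hk

theorem failProb_nonneg (n : ℕ) {p : ℝ} (hp : p ∈ Set.Icc (0 : ℝ) 1) : 0 ≤ failProb P n p := by
  classical
  exact bernSum_ite_nonneg hp

theorem failProb_le_one (n : ℕ) {p : ℝ} (hp : p ∈ Set.Icc (0 : ℝ) 1) : failProb P n p ≤ 1 := by
  classical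
  exact bernSum_ite_le_one hp

/-- The failure probability is a polynomial going from 1 to 0. The point found here serves as
threshold. -/
theorem exists_failProb_eq_half {n : ℕ} (hbot : ¬ P n ⊥) (htop : P n ⊤) :
    ∃ x ∈ Set.Icc (0 : ℝ) 1, failProb P n x = 1 / 2 := by
  classical
  have h0 : failProb P n 0 = 1 := by
    rw [failProb, bernSum_zero_left]
    simp [hbot]
  have h1 : failProb P n 1 = 0 := by
    rw [failProb, bernSum_one_left, SimpleGraph.coe_edgeFinset, SimpleGraph.fromEdgeSet_edgeSet]
    simp [htop]
  have hc : ContinuousOn (failProb P n) (Set.Icc 0 1) := (continuous_bernSum _ _).continuousOn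
  have := intermediate_value_Icc' zero_le_one hc
  rw [h0, h1] at this
  exact this ⟨by norm_num, by norm_num⟩

/-- Nontrivial monotone graph properties have thresholds. -/
theorem threshold_nonempty (hP : ∀ n, Monotone (P n)) (hbot : ∀ᶠ n in atTop, ¬ P n ⊥)
    (htop : ∀ᶠ n in atTop, P n ⊤) : (threshold P).Nonempty := by
  have hex : ∀ n, ∃ x : ℝ, ¬ P n ⊥ → P n ⊤ → x ∈ Set.Icc (0 : ℝ) 1 ∧ failProb P n x = 1 / 2 :=
    fun n => by
      by_cases h : ¬ P n ⊥ ∧ P n ⊤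
      · obtain ⟨x, hx⟩ := exists_failProb_eq_half h.1 h.2
        exact ⟨x, fun _ _ => hx⟩
      · exact ⟨0, fun h1 h2 => absurd ⟨h1, h2⟩ h⟩
  choose t ht using hex
  have ht' : ∀ᶠ n in atTop, t n ∈ Set.Icc (0 : ℝ) 1 ∧ failProb P n (t n) = 1 / 2 := by
    filter_upwards [hbot, htop] with n h1 h2 using ht n h1 h2
  refine ⟨t, fun p => ⟨fun h => ?_, fun h => ?_⟩⟩
  · simp only [prob_eq]
    suffices H : Tendsto (fun n => failProb P n (p n)) atTop (𝓝 0) by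
      simpa using H.const_sub 1
    rw [Metric.tendsto_atTop']
    intro ε hε
    obtain ⟨k, hk⟩ := exists_pow_lt_of_lt_one hε (by norm_num : (1 / 2 : ℝ) < 1)
    have hlit := isLittleO_iff.1 h (c := 1 / ((k : ℝ) + 1)) (by positivity)
    obtain ⟨N, hN⟩ := eventually_atTop.1 (hlit.and ht')
    refine ⟨N, fun n hn => ?_⟩
    obtain ⟨h1, h2, h3⟩ := hN n hn.le
    rw [Real.norm_of_nonneg h2.1, Real.norm_of_nonneg (p n).2.1, div_mul_eq_mul_div, one_mul,
      le_div_iff₀ (by positivity)] at h1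
    have h4 := failProb_le_pow_of_mul_le (k := k) (hP n) h2 (p n).2.2 (by nlinarith [h2.1])
    rw [h3] at h4
    rw [Real.dist_eq, sub_zero, abs_of_nonneg (failProb_nonneg n (p n).2)]
    exact h4.trans_lt hk
  · simp only [prob_eq]
    rw [Metric.tendsto_atTop']
    intro ε hε
    set δ := min ε 1 with hδ
    have hδ0 : 0 < δ := lt_min hε one_pos
    -- Here `k` copies of density `p n` fit below `t n`, so `1 / 2` is at most the `k`-th power of
    -- the failure probability, which forces the latter towards 1.
    have hδ1 : δ ≤ 1 := min_le_right _ _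
    obtain ⟨k, hk⟩ := exists_pow_lt_of_lt_one (by norm_num : (0 : ℝ) < 1 / 2)
      (by linarith : 1 - δ < 1)
    have hlit := isLittleO_iff.1 h (c := 1 / ((k : ℝ) + 1)) (by positivity)
    obtain ⟨N, hN⟩ := eventually_atTop.1 (hlit.and ht')
    refine ⟨N, fun n hn => ?_⟩
    obtain ⟨h1, h2, h3⟩ := hN n hn.le
    have hp0 : (0 : ℝ) ≤ p n := (p n).2.1
    rw [Real.norm_of_nonneg h2.1, Real.norm_of_nonneg hp0, div_mul_eq_mul_div, one_mul,
      le_div_iff₀ (by positivity)] at h1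
    have h4 := failProb_le_pow_of_mul_le (k := k) (hP n) (p n).2 h2.2 (by nlinarith)
    rw [h3] at h4
    have h5 : 1 - δ < failProb P n (p n) :=
      lt_of_pow_lt_pow_left₀ k (failProb_nonneg n (p n).2) (hk.trans_le h4)
    rw [Real.dist_eq, sub_zero, abs_of_nonneg (sub_nonneg.2 (failProb_le_one n (p n).2))]
    have : δ ≤ ε := min_le_left _ _
    linarith

end Threshold

/-! ### Class 0 in the random graph. -/

section ClassZero

variable {V : Type*} [Fintype V]

theorem isClassZero_top : IsClassZero (⊤ : SimpleGraph V) := by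
  refine isClassZero_iff.2 fun φ hφ x => ?_
  rcases Nat.eq_zero_or_pos (φ x) with hx | hx
  · obtain ⟨v, hv⟩ : ∃ v, 2 ≤ φ v := by
      by_contra h
      push Not at h
      have : ∑ v, φ v < ∑ _v : V, 1 :=
        Finset.sum_lt_sum (fun v _ => by have := h v; omega) ⟨x, Finset.mem_univ _, by omega⟩
      rw [hφ] at this
      simp at this
    have hvx : v ≠ x := by rintro rfl; omega
    exact potentialToPebble_of_walk
      (.cons (show (⊤ : SimpleGraph V).Adj v x from hvx) .nil) φ (by simpa using hv)
  · exact ⟨φ, .refl, hx⟩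

theorem not_isClassZero_bot [Nontrivial V] : ¬ IsClassZero (⊥ : SimpleGraph V) := by
  classical
  intro h
  obtain ⟨x, y, hxy⟩ := exists_pair_ne V
  obtain ⟨ψ, h1, h2⟩ := isClassZero_iff.1 h (Pi.single x (Fintype.card V)) (by simp) y
  rcases Relation.ReflTransGen.cases_head h1 with rfl | ⟨χ, ⟨a, b, hab, -⟩, -⟩
  · simp [hxy.symm] at h2
  · exact hab

/-- Choosing `k = ⌊n ^ (ε / 2)⌋` leaves room on both sides: `k - K ≥ n ^ (ε / 4)` reaches `n` in `L
≥ 4 / ε` steps, while `k * log n` stays below the average degree `n ^ ε`. -/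
theorem eventually_le_pow_floor {ε : ℝ} (hε : 0 < ε) (hε1 : ε ≤ 1) (K : ℕ) {L : ℕ}
    (hL : 4 / ε ≤ L) :
    ∀ᶠ n : ℕ in atTop, 6 * K < ⌊(n : ℝ) ^ (ε / 2)⌋₊ ∧ n ≤ (⌊(n : ℝ) ^ (ε / 2)⌋₊ - K) ^ L ∧
      3 * ⌊(n : ℝ) ^ (ε / 2)⌋₊ ≤ 2 * n ∧
      3 * ((⌊(n : ℝ) ^ (ε / 2)⌋₊ + 2) * Real.log n) ≤ (n : ℝ) ^ ε := by
  have hy : Tendsto (fun n : ℕ => (n : ℝ) ^ (ε / 4)) atTop atTop :=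
    (tendsto_rpow_atTop (by positivity)).comp tendsto_natCast_atTop_atTop
  have hlog : ∀ᶠ n : ℕ in atTop, ‖Real.log n‖ ≤ 1 / 9 * ‖(n : ℝ) ^ (ε / 2)‖ :=
    tendsto_natCast_atTop_atTop.eventually
      (isLittleO_iff.1 (isLittleO_log_rpow_atTop (half_pos hε)) (by norm_num))
  filter_upwards [hlog, hy.eventually_ge_atTop (6 * (K : ℝ) + 3), eventually_ge_atTop 3]
    with n h1 h2 h3
  have hn1 : (1 : ℝ) ≤ n := by exact_mod_cast (by omega : 1 ≤ n)
  have hn0 : (0 : ℝ) < n := by linarith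
  set y := (n : ℝ) ^ (ε / 4) with hydef
  have hx : (n : ℝ) ^ (ε / 2) = y ^ 2 := by
    rw [hydef, ← Real.rpow_mul_natCast hn0.le]
    congr 1
    push_cast
    ring
  have hz : (n : ℝ) ^ ε = (y ^ 2) ^ 2 := by
    rw [← hx, ← Real.rpow_mul_natCast hn0.le]
    congr 1
    push_cast
    ring
  have hyn : (y ^ 2) ^ 2 ≤ (n : ℝ) := by
    rw [← hz]
    simpa using Real.rpow_le_rpow_of_exponent_le hn1 hε1
  rw [hx] at h1 ⊢
  have hK0 : (0 : ℝ) ≤ K := Nat.cast_nonneg K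
  have hk1 : (⌊y ^ 2⌋₊ : ℝ) ≤ y ^ 2 := Nat.floor_le (by positivity)
  have hk2 : y ^ 2 < (⌊y ^ 2⌋₊ : ℝ) + 1 := Nat.lt_floor_add_one _
  set k := ⌊y ^ 2⌋₊
  have hk3 : 6 * K < k := by
    have : (6 * K : ℝ) < k := by nlinarith
    exact_mod_cast this
  refine ⟨hk3, ?_, ?_, ?_⟩
  · have h4 : y ≤ ((k - K : ℕ) : ℝ) := by
      rw [Nat.cast_sub (by omega)]
      nlinarith
    have h5 : (n : ℝ) ≤ y ^ L := by
      rw [hydef, ← Real.rpow_mul_natCast hn0.le]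
      conv_lhs => rw [← Real.rpow_one (n : ℝ)]
      refine Real.rpow_le_rpow_of_exponent_le hn1 ?_
      rw [div_le_iff₀ hε] at hL
      linarith
    exact_mod_cast h5.trans (pow_le_pow_left₀ (by linarith) h4 L)
  · have hy2 : 2 ≤ y ^ 2 := by nlinarith
    have : (3 * k : ℝ) ≤ 2 * n := by nlinarith
    exact_mod_cast this
  · have hl0 : 0 ≤ Real.log n := Real.log_nonneg hn1
    rw [Real.norm_of_nonneg hl0, Real.norm_of_nonneg (by positivity)] at h1
    rw [hz]
    calc 3 * (((k : ℝ) + 2) * Real.log n) ≤ 3 * ((3 * y ^ 2) * (1 / 9 * y ^ 2)) := by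
          have : (k : ℝ) + 2 ≤ 3 * y ^ 2 := by nlinarith
          gcongr
      _ = (y ^ 2) ^ 2 := by ring

theorem tendsto_prob_isClassZero {ε : ℝ} (hε : 0 < ε) (hε1 : ε ≤ 1) {p : ℕ → unitInterval}
    (hp : ∀ᶠ n : ℕ in atTop, (n : ℝ) ^ ε ≤ p n * n) :
    Tendsto (fun n => prob (fun _ G => IsClassZero G) n (p n)) atTop (𝓝 1) := by
  have hL := Nat.le_ceil (4 / ε)
  have hL0 : 0 < ⌈4 / ε⌉₊ := Nat.ceil_pos.2 (by positivity)
  set L := ⌈4 / ε⌉₊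
  have hlim : Tendsto (fun n : ℕ => 1 - Real.exp 2 / n) atTop (𝓝 1) := by
    simpa using (tendsto_const_div_atTop_nhds_zero_nat (Real.exp 2)).const_sub 1
  refine tendsto_of_tendsto_of_tendsto_of_le_of_le' hlim tendsto_const_nhds ?_
    (Eventually.of_forall fun n => MeasureTheory.measureReal_le_one)
  filter_upwards [hp, eventually_gt_atTop 0, eventually_le_pow_floor hε hε1
    (2 ^ (2 * L) * (2 * L + 1) * (4 * 2 ^ (2 * L) + 1)) hL] with n h1 h2 ⟨h3, h4, h5, h6⟩
  have hE := binomialRandom_real_not_expands_le (V := Fin n) (p n) ⌊(n : ℝ) ^ (ε / 2)⌋₊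
    (by simpa using h2) (by simpa using h6.trans h1)
  have hone : (1 : ℝ) ≤ (SimpleGraph.binomialRandom (Fin n) (p n)).real {G | IsClassZero G} +
      (SimpleGraph.binomialRandom (Fin n) (p n)).real
        {G | ¬ Expands G ⌊(n : ℝ) ^ (ε / 2)⌋₊} := by
    rw [← MeasureTheory.probReal_univ (μ := SimpleGraph.binomialRandom (Fin n) (p n))]
    refine le_trans (MeasureTheory.measureReal_mono ?_ (MeasureTheory.measure_ne_top _ _))
      (MeasureTheory.measureReal_union_le _ _)
    intro G _
    by_cases hG : Expands G ⌊(n : ℝ) ^ (ε / 2)⌋₊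
    · exact .inl (hG.isClassZero rfl rfl hL0 h3 (by simpa using h4) (by simpa using h5))
    · exact .inr hG
  rw [Fintype.card_fin] at hE
  rw [prob]
  linarith

theorem rpow_div_le_bound {d : ℝ} (hd : 0 < d) {n : ℕ} (hn : 2 ≤ n) :
    (n : ℝ) ^ (1 / d) / n ≤ bound d n := by
  have hn2 : (2 : ℝ) ≤ n := by exact_mod_cast hn
  have hlog : 1 ≤ Real.logb 2 n := by
    rw [Real.le_logb_iff_rpow_le (by norm_num) (by linarith)]
    simpa using hn2
  rw [bound]
  refine div_le_div_of_nonneg_right ?_ (by linarith)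
  exact Real.rpow_le_rpow (by linarith) (by nlinarith) (by positivity)

theorem tendsto_prob_isClassZero_of_bound_isLittleO {d : ℝ} (hd : 0 < d) {p : ℕ → unitInterval}
    (hp : bound d =o[atTop] fun n => (p n : ℝ)) :
    Tendsto (fun n => prob (fun _ G => IsClassZero G) n (p n)) atTop (𝓝 1) := by
  -- The cap at 1 covers `d < 1`.
  refine tendsto_prob_isClassZero (ε := min (1 / d) 1) (lt_min (by positivity) one_pos)
    (min_le_right _ _) ?_
  filter_upwards [isLittleO_iff.1 hp one_pos, eventually_ge_atTop 2] with n h1 h2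
  have hn1 : (1 : ℝ) ≤ n := by exact_mod_cast (by omega : 1 ≤ n)
  rw [one_mul, Real.norm_of_nonneg (p n).2.1] at h1
  have h3 := (rpow_div_le_bound hd h2).trans ((Real.le_norm_self _).trans h1)
  rw [div_le_iff₀ (by linarith)] at h3
  exact (Real.rpow_le_rpow_of_exponent_le hn1 (min_le_left _ _)).trans h3

theorem isLittleO_bound_of_mem_threshold {d : ℝ} (hd : 0 < d) {t : ℕ → ℝ}
    (ht : t ∈ threshold fun _ G => IsClassZero G) : t =o[atTop] bound d := by
  classical
  by_contra hcon
  rw [isLittleO_iff] at hcon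
  push Not at hcon
  obtain ⟨c, hc, hfreq⟩ := hcon
  -- Half the exponent `1 / d`: then `n ^ ε / n` is sufficient for Class 0 and yet `≪ bound d`.
  set ε := min (1 / (2 * d)) 1 with hεdef
  have hε : 0 < ε := lt_min (by positivity) one_pos
  have hε1 : ε ≤ 1 := min_le_right _ _
  have hεd : 2 * ε ≤ 1 / d := by
    have h1 : ε ≤ 1 / (2 * d) := min_le_left _ _
    have h2 : 2 * (1 / (2 * d)) = 1 / d := by field_simp
    linarith
  have hg : ∀ n : ℕ, (n : ℝ) ^ ε / n ∈ Set.Icc (0 : ℝ) 1 := fun n => by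
    refine ⟨by positivity, ?_⟩
    rcases Nat.eq_zero_or_pos n with rfl | hn
    · simp
    · have hn1 : (1 : ℝ) ≤ n := by exact_mod_cast hn
      rw [div_le_one (by linarith)]
      simpa using Real.rpow_le_rpow_of_exponent_le hn1 hε1
  set q : ℕ → unitInterval := fun n => ⟨(n : ℝ) ^ ε / n, hg n⟩ with hq
  have hq1 : Tendsto (fun n => prob (fun _ G => IsClassZero G) n (q n)) atTop (𝓝 1) := by
    refine tendsto_prob_isClassZero hε hε1 ?_
    filter_upwards [eventually_gt_atTop 0] with n hn
    have hn0 : (n : ℝ) ≠ 0 := by exact_mod_cast hn.ne'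
    exact (div_mul_cancel₀ _ hn0).ge
  -- Elsewhere `p` is 0, so `p ≪ t` holds whatever `t` does there. The threshold then sends the
  -- probability to 0, although `p = q` infinitely often and `q` sends it to 1.
  set p : ℕ → unitInterval := fun n => if c * ‖bound d n‖ < ‖t n‖ then q n else 0 with hpdef
  have hp : (fun n => (p n : ℝ)) =o[atTop] t := by
    rw [isLittleO_iff]
    intro δ hδ
    have hx : Tendsto (fun n : ℕ => (n : ℝ) ^ ε) atTop atTop :=
      (tendsto_rpow_atTop hε).comp tendsto_natCast_atTop_atTop
    filter_upwards [hx.eventually_ge_atTop (1 / (δ * c)), eventually_ge_atTop 2] with n h1 h2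
    by_cases h : c * ‖bound d n‖ < ‖t n‖
    · have hn1 : (1 : ℝ) ≤ n := by exact_mod_cast (by omega : 1 ≤ n)
      have hpn : (p n : ℝ) = (n : ℝ) ^ ε / n := congrArg Subtype.val (if_pos h)
      rw [hpn, Real.norm_of_nonneg (hg n).1]
      rw [div_le_iff₀ (by positivity)] at h1
      have h3 : (n : ℝ) ^ ε * (n : ℝ) ^ ε ≤ (n : ℝ) ^ (1 / d) := by
        rw [← Real.rpow_add (by linarith), ← two_mul]
        exact Real.rpow_le_rpow_of_exponent_le hn1 hεd
      have hx0 : 0 ≤ (n : ℝ) ^ ε := by positivity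
      calc (n : ℝ) ^ ε / n ≤ ((n : ℝ) ^ ε * (δ * c)) * (n : ℝ) ^ ε / n := by
            gcongr
            nlinarith
        _ = δ * (c * ((n : ℝ) ^ ε * (n : ℝ) ^ ε / n)) := by ring
        _ ≤ δ * (c * ((n : ℝ) ^ (1 / d) / n)) := by gcongr
        _ ≤ δ * (c * ‖bound d n‖) := by
            gcongr
            exact (rpow_div_le_bound hd h2).trans (Real.le_norm_self _)
        _ ≤ δ * ‖t n‖ := by gcongr
    · have hpn : (p n : ℝ) = 0 := congrArg Subtype.val (if_neg h)
      rw [hpn, norm_zero]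
      positivity
  have hp0 := (ht p).2 hp
  obtain ⟨n, h1, h2, h3⟩ := (hfreq.and_eventually
    ((hp0.eventually_lt_const (by norm_num : (0 : ℝ) < 1 / 2)).and
      (hq1.eventually_const_lt (by norm_num : (1 / 2 : ℝ) < 1)))).exists
  have hpq : p n = q n := if_pos h1
  rw [hpq] at h2
  exact lt_asymm h2 h3

end ClassZero

end Pebbling

theorem theorem2 :
    (Pebbling.threshold (fun _ G => Pebbling.IsClassZero G)).Nonempty ∧
    ∀ d : ℝ, 0 < d →
      Pebbling.threshold (fun _ G => Pebbling.IsClassZero G)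
        ⊆ {t | t =o[atTop] Pebbling.bound d} ∧
      ∀ p : ℕ → unitInterval,
        (Pebbling.bound d =o[atTop] fun n => (p n : ℝ)) →
        Tendsto (fun n => Pebbling.prob (fun _ G => Pebbling.IsClassZero G) n (p n))
          atTop (𝓝 1) := by
  refine ⟨Pebbling.threshold_nonempty (fun n G G' h hG => hG.mono h) ?_
    (Eventually.of_forall fun n => Pebbling.isClassZero_top), fun d hd =>
    ⟨fun t ht => Pebbling.isLittleO_bound_of_mem_threshold hd ht, fun p hp =>
      Pebbling.tendsto_prob_isClassZero_of_bound_isLittleO hd hp⟩⟩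
  filter_upwards [eventually_ge_atTop 2] with n hn
  have : Nontrivial (Fin n) := Fin.nontrivial_iff_two_le.2 hn
  exact Pebbling.not_isClassZero_bot
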